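/- Let $0<q<1$ and let $(e_n)_{n\in\mathbb{Z}}$ be the standard basis of the complex Hilbert space $\ell^2(\mathbb{Z})$. Let $A$ be the operator with domain $\operatorname{span}\{e_n\mid n\in\mathbb{Z}\}$ given by $Ae_n=q^{-n+1}e_{n-1}+q^{-n}e_{n+1}$, $n\in\mathbb{Z}$. Let $A_{\max}$ be the operator with domain $D$ consisting of all $\psi\in\ell^2(\mathbb{Z})$ for which the sequence $(q^{-n+1}\psi_{n-1}+q^{-n}\psi_{n+1})_{n\in\mathbb{Z}}$ belongs to $\ell^2(\mathbb{Z})$, and $A_{\max}\psi$ is this sequence. For $t\in\mathbb{R}\cup\{\infty\}$ let $A_t$ be the restriction of $A_{\max}$ to \[ \operatorname{Dom}A_t=\Big\{\psi\in D \;\Big|\; \lim_{n\to\infty}q^{-n}(\psi_{2n+1}+t\psi_{2n})=0\ \text{ and }\ \lim_{n\to\infty}q^{-n}(q\psi_{2n-1}-t\psi_{2n})=0\Big\}\quad\text{if } t\in\mathbb{R}, \] \[ \operatorname{Dom}A_\infty=\Big\{\psi\in D \;\Big|\; \lim_{n\to\infty}q^{-n}\psi_{2n}=0\Big\}. \] Then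 the operators $A_t$, $t\in\mathbb{R}\cup\{\infty\}$, are exactly all the self-adjoint extensions of $A$: each $A_t$ is a self-adjoint extension of $A$, and every self-adjoint operator in $\ell^2(\mathbb{Z})$ extending $A$ equals $A_t$ for some $t\in\mathbb{R}\cup\{\infty\}$. -/

import Mathlib

namespace QJacobi

noncomputable section

/-- The complex Hilbert space of square summable sequences indexed by the integers. -/
abbrev ellTwo : Type := lp (fun _ : ℤ => ℂ) 2

/-- The `n`-th vector of the standard basis. -/
def e (n : ℤ) : ellTwo := lp.single 2 n 1

/-- The action of the doubly infinite Jacobi matrix on arbitrary sequences: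
the `n`-th entry of the image of `ψ` is `q ^ (-n + 1) ψ (n - 1) + q ^ (-n) ψ (n + 1)`. -/
def jacobi (q : ℝ) : (ℤ → ℂ) →ₗ[ℂ] (ℤ → ℂ) where
  toFun ψ n := (q : ℂ) ^ (-n + 1) * ψ (n - 1) + (q : ℂ) ^ (-n) * ψ (n + 1)
  map_add' ψ χ := by
    funext n
    simp only [Pi.add_apply]
    ring
  map_smul' c ψ := by
    funext n
    simp only [Pi.smul_apply, smul_eq_mul, RingHom.id_apply]
    ring

/-- The maximal operator: `ψ` belongs to its domain if and only if both `ψ` and its image under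
the Jacobi matrix are square summable. -/
def Amax (q : ℝ) : ellTwo →ₗ.[ℂ] ellTwo where
  domain :=
    { carrier := {ψ | Memℓp (jacobi q ψ) 2}
      zero_mem' := by
        simp only [Set.mem_ofPred_eq, lp.coeFn_zero, map_zero]
        exact zero_memℓp
      add_mem' := by
        intro ψ χ hψ hχ
        simp only [Set.mem_ofPred_eq, lp.coeFn_add, map_add] at *
        exact hψ.add hχ
      smul_mem' := by
        intro c ψ hψ
        simp only [Set.mem_ofPred_eq, lp.coeFn_smul, map_smul] at *
        exact hψ.const_smul c }
  toFun :=
    { toFun := fun ψ => ⟨jacobi q (ψ : ellTwo), ψ.2⟩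
      map_add' := by
        intro ψ χ
        exact lp.ext (map_add (jacobi q) ((ψ : ellTwo) : ℤ → ℂ) ((χ : ellTwo) : ℤ → ℂ))
      map_smul' := by
        intro c ψ
        exact lp.ext (map_smul (jacobi q) c ((ψ : ellTwo) : ℤ → ℂ)) }

theorem mem_Amax_domain {q : ℝ} {ψ : ellTwo} :
    ψ ∈ (Amax q).domain ↔ Memℓp (jacobi q ψ) 2 := Iff.rfl

theorem Amax_apply (q : ℝ) (ψ : (Amax q).domain) (n : ℤ) :
    (Amax q ψ : ellTwo) n = (q : ℂ) ^ (-n + 1) * (ψ : ellTwo) (n - 1)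
      + (q : ℂ) ^ (-n) * (ψ : ellTwo) (n + 1) := rfl

theorem jacobi_e (q : ℝ) (n : ℤ) :
    jacobi q (e n) =
      (((q : ℂ) ^ (-n + 1) • e (n - 1) + (q : ℂ) ^ (-n) • e (n + 1) : ellTwo) : ℤ → ℂ) := by
  funext m
  simp only [jacobi, e, LinearMap.coe_mk, AddHom.coe_mk, lp.coeFn_add, lp.coeFn_smul,
    Pi.add_apply, Pi.smul_apply, smul_eq_mul, lp.coeFn_single, Pi.single_apply]
  by_cases h1 : m = n - 1
  · subst h1
    rw [if_neg (by omega), if_pos (by omega), if_pos rfl, if_neg (by omega)]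
    simp [add_comm, sub_eq_add_neg]
  · by_cases h2 : m = n + 1
    · subst h2
      rw [if_pos (by omega), if_neg (by omega), if_neg (by omega), if_pos rfl]
      simp [add_comm]
    · rw [if_neg (by omega), if_neg (by omega), if_neg h1, if_neg h2]
      simp

theorem span_e_le (q : ℝ) : Submodule.span ℂ (Set.range e) ≤ (Amax q).domain := by
  rw [Submodule.span_le]
  rintro _ ⟨n, rfl⟩
  change Memℓp (jacobi q (e n)) 2
  rw [jacobi_e]
  exact lp.memℓp _

/-- The minimally defined operator `A`, with domain the linear span of the standard basis. -/
def A (q : ℝ) : ellTwo →ₗ.[ℂ] ellTwo where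
  domain := Submodule.span ℂ (Set.range e)
  toFun := (Amax q).toFun ∘ₗ Submodule.inclusion (span_e_le q)

/-- The defining formula `A eₙ = q ^ (-n + 1) eₙ₋₁ + q ^ (-n) eₙ₊₁`. -/
theorem A_e (q : ℝ) (n : ℤ) :
    A q ⟨e n, Submodule.subset_span ⟨n, rfl⟩⟩
      = (q : ℂ) ^ (-n + 1) • e (n - 1) + (q : ℂ) ^ (-n) • e (n + 1) :=
  lp.ext (jacobi_e q n)

/-- The boundary condition at `+∞` with parameter `t ∈ ℝ ∪ {∞}`. -/
def BoundaryCondition (q : ℝ) : OnePoint ℝ → (ℤ → ℂ) → Prop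
  | OnePoint.infty, ψ =>
      Filter.Tendsto (fun n : ℤ => (q : ℂ) ^ (-n) * ψ (2 * n)) Filter.atTop (nhds 0)
  | OnePoint.some t, ψ =>
      Filter.Tendsto (fun n : ℤ => (q : ℂ) ^ (-n) * (ψ (2 * n + 1) + (t : ℂ) * ψ (2 * n)))
        Filter.atTop (nhds 0) ∧
      Filter.Tendsto (fun n : ℤ => (q : ℂ) ^ (-n) * ((q : ℂ) * ψ (2 * n - 1) - (t : ℂ) * ψ (2 * n)))
        Filter.atTop (nhds 0)

theorem BoundaryCondition.zero (q : ℝ) (t : OnePoint ℝ) : BoundaryCondition q t 0 := by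
  induction t using OnePoint.rec <;> simp [BoundaryCondition]

theorem BoundaryCondition.add {q : ℝ} {t : OnePoint ℝ} {ψ χ : ℤ → ℂ}
    (hψ : BoundaryCondition q t ψ) (hχ : BoundaryCondition q t χ) :
    BoundaryCondition q t (ψ + χ) := by
  induction t using OnePoint.rec with
  | infty =>
    have h := Filter.Tendsto.add hψ hχ
    rw [add_zero] at h
    refine h.congr fun n => ?_
    simp only [Pi.add_apply]
    ring
  | coe t =>
    have h₁ := Filter.Tendsto.add hψ.1 hχ.1
    have h₂ := Filter.Tendsto.add hψ.2 hχ.2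
    rw [add_zero] at h₁ h₂
    refine ⟨h₁.congr fun n => ?_, h₂.congr fun n => ?_⟩ <;>
    · simp only [Pi.add_apply]
      ring

theorem BoundaryCondition.smul {q : ℝ} {t : OnePoint ℝ} (c : ℂ) {ψ : ℤ → ℂ}
    (hψ : BoundaryCondition q t ψ) : BoundaryCondition q t (c • ψ) := by
  induction t using OnePoint.rec with
  | infty =>
    have h := Filter.Tendsto.const_mul c hψ
    rw [mul_zero] at h
    refine h.congr fun n => ?_
    simp only [Pi.smul_apply, smul_eq_mul]
    ring
  | coe t =>
    have h₁ := Filter.Tendsto.const_mul c hψ.1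
    have h₂ := Filter.Tendsto.const_mul c hψ.2
    rw [mul_zero] at h₁ h₂
    refine ⟨h₁.congr fun n => ?_, h₂.congr fun n => ?_⟩ <;>
    · simp only [Pi.smul_apply, smul_eq_mul]
      ring

/-- The domain of `At q t`. -/
def AtDomain (q : ℝ) (t : OnePoint ℝ) : Submodule ℂ ellTwo where
  carrier := {ψ | ψ ∈ (Amax q).domain ∧ BoundaryCondition q t ψ}
  zero_mem' := ⟨zero_mem _, BoundaryCondition.zero q t⟩
  add_mem' hψ hχ := ⟨add_mem hψ.1 hχ.1, hψ.2.add hχ.2⟩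
  smul_mem' c _ hψ := ⟨Submodule.smul_mem _ c hψ.1, hψ.2.smul c⟩

theorem AtDomain_le (q : ℝ) (t : OnePoint ℝ) : AtDomain q t ≤ (Amax q).domain :=
  fun _ hψ => hψ.1

/-- The restriction of the maximal operator to the sequences satisfying the boundary condition
with parameter `t`. -/
def At (q : ℝ) (t : OnePoint ℝ) : ellTwo →ₗ.[ℂ] ellTwo where
  domain := AtDomain q t
  toFun := (Amax q).toFun ∘ₗ Submodule.inclusion (AtDomain_le q t)

theorem At_le_Amax (q : ℝ) (t : OnePoint ℝ) : At q t ≤ Amax q := by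
  refine ⟨AtDomain_le q t, ?_⟩
  rintro ⟨x, hx⟩ ⟨y, hy⟩ h
  obtain rfl : x = y := h
  rfl

end

end QJacobi

/-!
If `ψ` lies in the domain of the maximal operator `Amax = A†`, the rescaled pairs
`(-q) ^ (-k) (ψ₂ₖ, ψ₂ₖ₊₁)` change at step `k` by at most a multiple of `q ^ k`, hence converge to a
pair `(v, u)` of boundary values. Summation by parts expresses the failure of `Amax` to be symmetric
through a Wronskian that vanishes at `-∞` and tends at `+∞` to a skew-Hermitian form of the boundary
values. Self-adjoint extensions of `A` therefore correspond to the subspaces of `ℂ × ℂ` that are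
their own orthogonal complement for this form, and these are the lines `u + t v = 0` with `t` real
together with the line `v = 0`.
-/

section BoundaryRestriction

variable {R E F V : Type*} [Ring R] [AddCommGroup E] [Module R E] [AddCommGroup F] [Module R F]
  [AddCommGroup V] [Module R V]

theorem linearPMap_le_of_domain_le {T T' S : E →ₗ.[R] F} (hT : T ≤ S) (hT' : T' ≤ S)
    (h : T.domain ≤ T'.domain) : T ≤ T' :=
  ⟨h, fun x _ hxy => (hT.2 (y := ⟨x, hT.1 x.2⟩) rfl).trans (hT'.2 hxy.symm).symm⟩

/-- The restriction of `S` to the vectors whose boundary value under `Γ` lies in `L`. -/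
def boundaryRestriction (S : E →ₗ.[R] F) (Γ : S.domain →ₗ[R] V) (L : Submodule R V) :
    E →ₗ.[R] F :=
  S.domRestrict ((L.comap Γ).map S.domain.subtype)

/-- The space of boundary values under `Γ` of the vectors that lie in the domain of `T`. -/
def boundarySpace {S : E →ₗ.[R] F} (Γ : S.domain →ₗ[R] V) (T : E →ₗ.[R] F) : Submodule R V :=
  (T.domain.comap S.domain.subtype).map Γ

variable {S T : E →ₗ.[R] F} {Γ : S.domain →ₗ[R] V} {L : Submodule R V}

theorem boundaryRestriction_le : boundaryRestriction S Γ L ≤ S :=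
  LinearPMap.domRestrict_le

theorem coe_mem_boundaryRestriction_domain {ψ : S.domain} :
    (ψ : E) ∈ (boundaryRestriction S Γ L).domain ↔ Γ ψ ∈ L := by
  simp [boundaryRestriction]

theorem le_boundaryRestriction_iff (hT : T ≤ S) :
    T ≤ boundaryRestriction S Γ L ↔ ∀ ψ : S.domain, (ψ : E) ∈ T.domain → Γ ψ ∈ L :=
  ⟨fun h _ hψ => coe_mem_boundaryRestriction_domain.1 (h.1 hψ),
    fun h => linearPMap_le_of_domain_le hT boundaryRestriction_le fun x hx =>
      coe_mem_boundaryRestriction_domain (ψ := ⟨x, hT.1 hx⟩).2 (h _ hx)⟩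

theorem eq_boundaryRestriction (hT : T ≤ S)
    (h : ∀ ψ : S.domain, (ψ : E) ∈ T.domain ↔ Γ ψ ∈ L) : T = boundaryRestriction S Γ L :=
  le_antisymm ((le_boundaryRestriction_iff hT).2 fun ψ => (h ψ).1)
    (linearPMap_le_of_domain_le boundaryRestriction_le hT fun x hx =>
      (h ⟨x, hx.2⟩).2 (coe_mem_boundaryRestriction_domain.1 hx))

theorem boundarySpace_boundaryRestriction (hΓ : Function.Surjective Γ) :
    boundarySpace Γ (boundaryRestriction S Γ L) = L := by
  have hcomap : (boundaryRestriction S Γ L).domain.comap S.domain.subtype = L.comap Γ :=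
    Submodule.ext fun _ => coe_mem_boundaryRestriction_domain
  rw [boundarySpace, hcomap, Submodule.map_comap_eq_of_surjective hΓ]

end BoundaryRestriction

section SelfAdjointExtensions

open LinearPMap
open scoped InnerProductSpace

variable {𝕜 E F V : Type*} [RCLike 𝕜] [NormedAddCommGroup E] [InnerProductSpace 𝕜 E]
  [NormedAddCommGroup F] [InnerProductSpace 𝕜 F] [AddCommGroup V] [Module 𝕜 V] [CompleteSpace E]

theorem linearPMap_adjoint_le_adjoint {T T' : E →ₗ.[𝕜] F}
    (hT : Dense (T.domain : Set E)) (h : T ≤ T') : T'† ≤ T† := by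
  refine IsFormalAdjoint.le_adjoint hT fun x y => ?_
  rw [h.2 (y := ⟨x, h.1 x.2⟩) rfl]
  exact (adjoint_isFormalAdjoint (hT.mono h.1)).symm _ y

/-- `Γ` is a boundary map for the densely defined symmetric operator `A` with adjoint `S`:
it maps the domain of `S` onto the space `V` of boundary values, and the failure of `S` to be
symmetric is the sesquilinear form `ω` of the boundary values. This is a boundary triple whose
boundary space is not split into two halves. -/
structure IsBoundaryMap (A S : E →ₗ.[𝕜] E) (ω : V →ₗ⋆[𝕜] V →ₗ[𝕜] 𝕜) (Γ : S.domain →ₗ[𝕜] V) :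
    Prop where
  dense_domain : Dense (A.domain : Set E)
  le : A ≤ S
  adjoint_eq : A† = S
  surjective : Function.Surjective Γ
  green (ψ χ : S.domain) : ⟪S ψ, (χ : E)⟫_𝕜 - ⟪(ψ : E), S χ⟫_𝕜 = ω (Γ ψ) (Γ χ)

namespace IsBoundaryMap

variable {A S T : E →ₗ.[𝕜] E} {ω : V →ₗ⋆[𝕜] V →ₗ[𝕜] 𝕜} {Γ : S.domain →ₗ[𝕜] V}

theorem adjoint_le (hΓ : IsBoundaryMap A S ω Γ) (hAT : A ≤ T) : T† ≤ S :=
  hΓ.adjoint_eq ▸ linearPMap_adjoint_le_adjoint hΓ.dense_domain hAT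

theorem coe_mem_adjoint_domain_iff (hΓ : IsBoundaryMap A S ω Γ) (hAT : A ≤ T) (hTS : T ≤ S)
    {ψ : S.domain} :
    (ψ : E) ∈ T†.domain ↔ ∀ χ : S.domain, (χ : E) ∈ T.domain → ω (Γ χ) (Γ ψ) = 0 := by
  have hT : Dense (T.domain : Set E) := hΓ.dense_domain.mono hAT.1
  have hTS_apply (χ : T.domain) : T χ = S ⟨χ, hTS.1 χ.2⟩ := hTS.2 rfl
  simp only [← hΓ.green, sub_eq_zero]
  constructor
  · intro hψ χ hχ
    rw [← hTS_apply ⟨χ, hχ⟩, ← (hΓ.adjoint_le hAT).2 (x := ⟨ψ, hψ⟩) rfl]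
    exact (adjoint_isFormalAdjoint hT).symm ⟨χ, hχ⟩ ⟨ψ, hψ⟩
  · intro h
    refine mem_adjoint_domain_of_exists _ ⟨S ψ, fun χ => ?_⟩
    rw [hTS_apply, ← inner_conj_symm, ← h ⟨χ, hTS.1 χ.2⟩ χ.2, inner_conj_symm]

theorem adjoint_eq_boundaryRestriction (hΓ : IsBoundaryMap A S ω Γ) (hAT : A ≤ T) (hTS : T ≤ S) :
    T† = boundaryRestriction S Γ ((boundarySpace Γ T).orthogonalBilin ω) := by
  refine eq_boundaryRestriction (hΓ.adjoint_le hAT) fun ψ => ?_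
  rw [hΓ.coe_mem_adjoint_domain_iff hAT hTS, Submodule.mem_orthogonalBilin_iff]
  simp only [boundarySpace, Submodule.mem_map, Submodule.mem_comap, Submodule.subtype_apply,
    forall_exists_index, and_imp, forall_apply_eq_imp_iff₂]

theorem le_boundaryRestriction_orthogonalBilin (hΓ : IsBoundaryMap A S ω Γ)
    (L : Submodule 𝕜 V) : A ≤ boundaryRestriction S Γ (L.orthogonalBilin ω) := by
  refine (le_boundaryRestriction_iff hΓ.le).2 fun ψ hψ v _ => ?_
  obtain ⟨χ, rfl⟩ := hΓ.surjective v
  have hformal : S.IsFormalAdjoint A :=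
    hΓ.adjoint_eq ▸ adjoint_isFormalAdjoint hΓ.dense_domain
  change ω (Γ χ) (Γ ψ) = 0
  rw [← hΓ.green, sub_eq_zero, ← hΓ.le.2 (x := ⟨ψ, hψ⟩) rfl]
  exact hformal χ ⟨ψ, hψ⟩

theorem isSelfAdjoint_boundaryRestriction (hΓ : IsBoundaryMap A S ω Γ) {L : Submodule 𝕜 V}
    (hL : L.orthogonalBilin ω = L) : IsSelfAdjoint (boundaryRestriction S Γ L) := by
  have hA : A ≤ boundaryRestriction S Γ L := by
    simpa only [hL] using hΓ.le_boundaryRestriction_orthogonalBilin L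
  rw [isSelfAdjoint_def, hΓ.adjoint_eq_boundaryRestriction hA boundaryRestriction_le,
    boundarySpace_boundaryRestriction hΓ.surjective, hL]

theorem exists_boundaryRestriction_eq (hΓ : IsBoundaryMap A S ω Γ) (hAT : A ≤ T)
    (hT : IsSelfAdjoint T) :
    ∃ L : Submodule 𝕜 V, L.orthogonalBilin ω = L ∧ boundaryRestriction S Γ L = T := by
  rw [isSelfAdjoint_def] at hT
  have hTS : T ≤ S := hT ▸ hΓ.adjoint_le hAT
  have hrestrict : boundaryRestriction S Γ ((boundarySpace Γ T).orthogonalBilin ω) = T :=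
    (hΓ.adjoint_eq_boundaryRestriction hAT hTS).symm.trans hT
  have hlagrangian : (boundarySpace Γ T).orthogonalBilin ω = boundarySpace Γ T := by
    conv_rhs => rw [← hrestrict]
    exact (boundarySpace_boundaryRestriction hΓ.surjective).symm
  exact ⟨boundarySpace Γ T, hlagrangian, hlagrangian ▸ hrestrict⟩

theorem setOf_isSelfAdjoint_eq_image (hΓ : IsBoundaryMap A S ω Γ) :
    {T | A ≤ T ∧ IsSelfAdjoint T} =
      boundaryRestriction S Γ '' {L | L.orthogonalBilin ω = L} := by
  ext T
  constructor
  · rintro ⟨hAT, hT⟩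
    exact hΓ.exists_boundaryRestriction_eq hAT hT
  · rintro ⟨L, hL, rfl⟩
    refine ⟨?_, hΓ.isSelfAdjoint_boundaryRestriction hL⟩
    simpa only [show L.orthogonalBilin ω = L from hL] using
      hΓ.le_boundaryRestriction_orthogonalBilin L

end IsBoundaryMap

end SelfAdjointExtensions

section Limits

open Filter Topology

theorem exists_tendsto_atTop_of_norm_sub_le_geometric {E : Type*} [NormedAddCommGroup E]
    [CompleteSpace E] {f : ℤ → E} {C r : ℝ} (hr : r < 1)
    (hf : ∀ k : ℤ, ‖f (k + 1) - f k‖ ≤ C * r ^ k) : ∃ x, Tendsto f atTop (𝓝 x) := by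
  have hcauchy : CauchySeq fun k : ℕ => f k :=
    cauchySeq_of_le_geometric r C hr fun k => by
      rw [dist_comm, dist_eq_norm]
      exact_mod_cast hf k
  obtain ⟨x, hx⟩ := cauchySeq_tendsto_of_complete hcauchy
  exact ⟨x, by rwa [← Nat.map_cast_int_atTop, tendsto_map'_iff]⟩

theorem tendsto_atTop_of_hasSum_sub {G : Type*} [AddCommGroup G] [TopologicalSpace G]
    [IsTopologicalAddGroup G] {f : ℤ → G} {a b : G} (hsum : HasSum (fun n => f n - f (n - 1)) a)
    (hbot : Tendsto f atBot (𝓝 b)) : Tendsto f atTop (𝓝 (a + b)) := by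
  have hpartial : Tendsto (fun N : ℕ => f (N - 1) - f (-N - 1)) atTop (𝓝 a) := by
    refine (hsum.comp (Finset.tendsto_Ico_neg (R := ℤ))).congr fun N => ?_
    simpa using congrArg Neg.neg (Finset.sum_Ico_int_sub N fun n => f (n - 1))
  have hneg : Tendsto (fun N : ℕ => (-N - 1 : ℤ)) atTop atBot :=
    tendsto_atBot_add_const_right _ (-1)
      (tendsto_neg_atTop_atBot.comp tendsto_natCast_atTop_atTop)
  have hpred : Tendsto (fun N : ℕ => f (N - 1)) atTop (𝓝 (a + b)) := by
    simpa using hpartial.add (hbot.comp hneg)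
  have hint : Tendsto (fun n : ℤ => f (n - 1)) atTop (𝓝 (a + b)) := by
    rwa [← Nat.map_cast_int_atTop, tendsto_map'_iff]
  simpa [Function.comp_def] using hint.comp (tendsto_atTop_add_const_right atTop 1 tendsto_id)

theorem tendsto_neg_zpow_mul_zero_iff {α 𝕜 : Type*} [NormedDivisionRing 𝕜] {q : 𝕜}
    {l : Filter α} (m : α → ℤ) (f : α → 𝕜) :
    Tendsto (fun a => (-q) ^ m a * f a) l (𝓝 0) ↔ Tendsto (fun a => q ^ m a * f a) l (𝓝 0) := by
  rw [tendsto_zero_iff_norm_tendsto_zero,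
    tendsto_zero_iff_norm_tendsto_zero (f := fun a => q ^ m a * f a)]
  simp only [norm_mul, norm_zpow, norm_neg]

end Limits

namespace QJacobi

open Filter Topology ComplexConjugate

section BoundaryForm

/-- The skew-Hermitian form on the space `ℂ × ℂ` of boundary values in Green's identity for the
maximal operator. -/
def boundaryForm : ℂ × ℂ →ₗ⋆[ℂ] ℂ × ℂ →ₗ[ℂ] ℂ :=
  LinearMap.mk₂'ₛₗ (starRingEnd ℂ) (RingHom.id ℂ) (fun x y => conj x.2 * y.1 - conj x.1 * y.2)
    (fun _ _ _ => by simp only [Prod.fst_add, Prod.snd_add, map_add]; ring)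
    (fun _ _ _ => by simp only [Prod.smul_fst, Prod.smul_snd, smul_eq_mul, map_mul]; ring)
    (fun _ _ _ => by simp only [Prod.fst_add, Prod.snd_add]; ring)
    (fun _ _ _ => by
      simp only [Prod.smul_fst, Prod.smul_snd, smul_eq_mul, RingHom.id_apply]; ring)

theorem boundaryForm_apply (x y : ℂ × ℂ) :
    boundaryForm x y = conj x.2 * y.1 - conj x.1 * y.2 :=
  rfl

/-- The Lagrangian lines of `boundaryForm`, parametrised by `ℝ ∪ {∞}`. A pair `(v, u)` stands for
the limits of the rescaled entries of a sequence with even and odd index, respectively. -/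
def boundaryLine : OnePoint ℝ → Submodule ℂ (ℂ × ℂ)
  | OnePoint.infty => LinearMap.ker (LinearMap.fst ℂ ℂ ℂ)
  | OnePoint.some t => LinearMap.ker (LinearMap.snd ℂ ℂ ℂ + (t : ℂ) • LinearMap.fst ℂ ℂ ℂ)

theorem mem_boundaryLine_infty {x : ℂ × ℂ} : x ∈ boundaryLine OnePoint.infty ↔ x.1 = 0 :=
  Iff.rfl

theorem mem_boundaryLine_coe {t : ℝ} {x : ℂ × ℂ} :
    x ∈ boundaryLine (t : OnePoint ℝ) ↔ x.2 + t * x.1 = 0 :=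
  Iff.rfl

theorem boundaryForm_eq_zero_of_mem_boundaryLine {t : OnePoint ℝ} {x y : ℂ × ℂ}
    (hx : x ∈ boundaryLine t) (hy : y ∈ boundaryLine t) : boundaryForm x y = 0 := by
  rw [boundaryForm_apply]
  induction t using OnePoint.rec with
  | infty =>
    rw [mem_boundaryLine_infty] at hx hy
    simp [hx, hy]
  | coe t =>
    rw [mem_boundaryLine_coe] at hx hy
    rw [eq_neg_of_add_eq_zero_left hx, eq_neg_of_add_eq_zero_left hy]
    simp only [map_neg, map_mul, Complex.conj_ofReal]
    ring

theorem mem_boundaryLine_of_boundaryForm_eq_zero {t : OnePoint ℝ} {x y : ℂ × ℂ}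
    (hx : x ∈ boundaryLine t) (hx₀ : x ≠ 0) (h : boundaryForm x y = 0) : y ∈ boundaryLine t := by
  rw [boundaryForm_apply] at h
  induction t using OnePoint.rec with
  | infty =>
    rw [mem_boundaryLine_infty] at hx ⊢
    have hx₂ : x.2 ≠ 0 := fun hx₂ => hx₀ (Prod.ext hx hx₂)
    simpa [hx, hx₂] using h
  | coe t =>
    rw [mem_boundaryLine_coe] at hx ⊢
    have hx₂ : x.2 = -(t * x.1) := eq_neg_of_add_eq_zero_left hx
    have hx₁ : x.1 ≠ 0 := fun hx₁ => hx₀ (Prod.ext hx₁ (by simp [hx₂, hx₁]))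
    have hfactor : conj x.1 * (y.2 + t * y.1) = 0 := by
      rw [hx₂, map_neg, map_mul, Complex.conj_ofReal] at h
      linear_combination -h
    exact (mul_eq_zero.1 hfactor).resolve_left ((map_ne_zero _).2 hx₁)

theorem exists_ne_zero_mem_boundaryLine (t : OnePoint ℝ) : ∃ x ∈ boundaryLine t, x ≠ 0 := by
  induction t using OnePoint.rec with
  | infty => exact ⟨(0, 1), mem_boundaryLine_infty.2 rfl, by simp⟩
  | coe t => exact ⟨(1, -t), mem_boundaryLine_coe.2 (by simp), by simp⟩

theorem orthogonalBilin_boundaryLine (t : OnePoint ℝ) :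
    (boundaryLine t).orthogonalBilin boundaryForm = boundaryLine t := by
  obtain ⟨x, hx, hx₀⟩ := exists_ne_zero_mem_boundaryLine t
  exact le_antisymm
    (fun y hy => mem_boundaryLine_of_boundaryForm_eq_zero hx hx₀ (hy x hx))
    (fun y hy z hz => boundaryForm_eq_zero_of_mem_boundaryLine hz hy)

theorem exists_mem_boundaryLine_of_boundaryForm_self_eq_zero {x : ℂ × ℂ}
    (h : boundaryForm x x = 0) : ∃ t, x ∈ boundaryLine t := by
  by_cases hx : x.1 = 0
  · exact ⟨OnePoint.infty, hx⟩
  have hreal : conj (-(x.2 / x.1)) = -(x.2 / x.1) := by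
    rw [boundaryForm_apply] at h
    rw [map_neg, map_div₀, neg_inj, div_eq_div_iff ((map_ne_zero _).2 hx) hx]
    linear_combination h
  obtain ⟨t, ht⟩ := Complex.conj_eq_iff_real.1 hreal
  refine ⟨t, mem_boundaryLine_coe.2 ?_⟩
  rw [← ht]
  field_simp
  ring

theorem exists_boundaryLine_eq {L : Submodule ℂ (ℂ × ℂ)}
    (hL : L.orthogonalBilin boundaryForm = L) : ∃ t, boundaryLine t = L := by
  have hL₀ : L ≠ ⊥ := by
    rintro rfl
    have hmem : ((1, 0) : ℂ × ℂ) ∈ (⊥ : Submodule ℂ (ℂ × ℂ)) :=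
      hL.le fun x hx => by simp [(Submodule.mem_bot ℂ).1 hx]
    simp at hmem
  obtain ⟨x, hxL, hx₀⟩ := L.exists_mem_ne_zero_of_ne_bot hL₀
  have hx_ortho {y : ℂ × ℂ} (hy : y ∈ L) : boundaryForm x y = 0 := (hL.ge hy) x hxL
  obtain ⟨t, ht⟩ := exists_mem_boundaryLine_of_boundaryForm_self_eq_zero (hx_ortho hxL)
  have hle : L ≤ boundaryLine t := fun y hy =>
    mem_boundaryLine_of_boundaryForm_eq_zero ht hx₀ (hx_ortho hy)
  refine ⟨t, le_antisymm ?_ hle⟩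
  calc boundaryLine t = (boundaryLine t).orthogonalBilin boundaryForm :=
        (orthogonalBilin_boundaryLine t).symm
    _ ≤ L.orthogonalBilin boundaryForm := Submodule.orthogonalBilin_le hle
    _ = L := hL

theorem setOf_orthogonalBilin_boundaryForm_eq_self :
    {L : Submodule ℂ (ℂ × ℂ) | L.orthogonalBilin boundaryForm = L} = Set.range boundaryLine :=
  Set.Subset.antisymm (fun _ => exists_boundaryLine_eq)
    (Set.range_subset_iff.2 orthogonalBilin_boundaryLine)

theorem tendsto_boundaryForm {α : Type*} {l : Filter α} {f g : α → ℂ × ℂ} {x y : ℂ × ℂ}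
    (hf : Tendsto f l (𝓝 x)) (hg : Tendsto g l (𝓝 y)) :
    Tendsto (fun a => boundaryForm (f a) (g a)) l (𝓝 (boundaryForm x y)) := by
  have hconj {z : ℂ} := (Complex.continuous_conj.tendsto z)
  exact ((hconj.comp hf.snd_nhds).mul hg.fst_nhds).sub ((hconj.comp hf.fst_nhds).mul hg.snd_nhds)

end BoundaryForm

section MaximalOperator

open LinearPMap
open scoped InnerProductSpace

variable {q : ℝ}

theorem inner_e_left (n : ℤ) (ψ : ellTwo) : ⟪e n, ψ⟫_ℂ = ψ n := by
  simp [e, lp.inner_single_left]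

theorem e_mem_A_domain (q : ℝ) (n : ℤ) : e n ∈ (A q).domain :=
  Submodule.subset_span ⟨n, rfl⟩

theorem inner_A_e (q : ℝ) (n : ℤ) (ψ : ellTwo) :
    ⟪A q ⟨e n, e_mem_A_domain q n⟩, ψ⟫_ℂ = jacobi q ψ n := by
  rw [A_e, inner_add_left, inner_smul_left, inner_smul_left, inner_e_left, inner_e_left]
  simp [jacobi]

theorem dense_A_domain (q : ℝ) : Dense ((A q).domain : Set ellTwo) := by
  rw [Submodule.dense_iff_topologicalClosure_eq_top, Submodule.topologicalClosure_eq_top_iff,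
    Submodule.eq_bot_iff]
  intro ψ hψ
  ext n
  rw [← inner_e_left, (Submodule.mem_orthogonal _ _).1 hψ _ (e_mem_A_domain q n), lp.coeFn_zero,
    Pi.zero_apply]

theorem A_le_Amax (q : ℝ) : A q ≤ Amax q :=
  ⟨span_e_le q, fun _ _ hxy => congrArg (Amax q) (Subtype.ext hxy)⟩

theorem A_isFormalAdjoint_Amax (q : ℝ) : (A q).IsFormalAdjoint (Amax q) := by
  refine IsFormalAdjoint.symm fun ψ => LinearMap.congr_fun
    (f := innerₛₗ ℂ (Amax q ψ) ∘ₗ (A q).domain.subtype)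
    (g := innerₛₗ ℂ (ψ : ellTwo) ∘ₗ (A q).toFun) ?_
  refine (Submodule.linearMap_eq_iff_of_eq_span (V := (A q).domain) _ _ rfl).2 ?_
  rintro ⟨_, n, rfl⟩
  change ⟪Amax q ψ, e n⟫_ℂ = ⟪(ψ : ellTwo), A q ⟨e n, _⟩⟫_ℂ
  rw [← inner_conj_symm, inner_e_left, ← inner_conj_symm (ψ : ellTwo), inner_A_e]
  rfl

theorem adjoint_A (q : ℝ) : (A q)† = Amax q := by
  have hdense := dense_A_domain q
  have hcoord (ψ : (A q)†.domain) : ((A q)† ψ : ℤ → ℂ) = jacobi q (ψ : ellTwo) := by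
    funext n
    rw [← inner_e_left, ← inner_A_e]
    exact ((adjoint_isFormalAdjoint hdense).symm ⟨e n, e_mem_A_domain q n⟩ ψ).symm
  refine ((A_isFormalAdjoint_Amax q).le_adjoint hdense).antisymm'
    ⟨fun ψ hψ => ?_, fun ψ χ hψχ => lp.ext ?_⟩
  · rw [mem_Amax_domain, ← hcoord ⟨ψ, hψ⟩]
    exact lp.memℓp _
  · rw [hcoord, hψχ]
    rfl

end MaximalOperator

noncomputable section BoundaryMap

/-- The boundary form of the Jacobi matrix across the edge between `n` and `n + 1`. -/
def wronskian (q : ℝ) (ψ χ : ℤ → ℂ) (n : ℤ) : ℂ :=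
  (q : ℂ) ^ (-n) * (conj (ψ (n + 1)) * χ n - conj (ψ n) * χ (n + 1))

/-- The `k`-th pair of an even and an odd entry of `ψ`, rescaled so that it does not depend on `k`
if the Jacobi matrix annihilates `ψ`. -/
def rescaledPair (q : ℝ) (k : ℤ) : (ℤ → ℂ) →ₗ[ℂ] ℂ × ℂ :=
  (-q : ℂ) ^ (-k) • (LinearMap.proj (2 * k)).prod (LinearMap.proj (2 * k + 1))

theorem rescaledPair_apply (q : ℝ) (k : ℤ) (ψ : ℤ → ℂ) :
    rescaledPair q k ψ = ((-q : ℂ) ^ (-k) * ψ (2 * k), (-q : ℂ) ^ (-k) * ψ (2 * k + 1)) :=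
  rfl

variable {q : ℝ}

theorem rescaledPair_succ_sub (hq : q ≠ 0) (ψ : ℤ → ℂ) (k : ℤ) :
    rescaledPair q (k + 1) ψ - rescaledPair q k ψ =
      (-q : ℂ) ^ (-(k + 1)) • ((q : ℂ) ^ (2 * k + 1) * jacobi q ψ (2 * k + 1),
        (q : ℂ) ^ (2 * k + 2) * jacobi q ψ (2 * k + 2)) := by
  have hq : (q : ℂ) ≠ 0 := by exact_mod_cast hq
  have hneg : (-q : ℂ) ^ (-k) = -q * (-q : ℂ) ^ (-(k + 1)) := by
    rw [mul_comm, ← zpow_add_one₀ (neg_ne_zero.2 hq), neg_add, neg_add_cancel_right]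
  have hjacobi (n : ℤ) : (q : ℂ) ^ n * jacobi q ψ n = q * ψ (n - 1) + ψ (n + 1) := by
    change (q : ℂ) ^ n * ((q : ℂ) ^ (-n + 1) * ψ (n - 1) + (q : ℂ) ^ (-n) * ψ (n + 1)) = _
    rw [zpow_add_one₀ hq, zpow_neg]
    field_simp
  rw [rescaledPair_apply, rescaledPair_apply, hjacobi, hjacobi, hneg]
  simp only [Prod.mk_sub_mk, Prod.smul_mk, smul_eq_mul]
  ext <;> ring_nf

theorem wronskian_two_mul (ψ χ : ℤ → ℂ) (k : ℤ) :
    wronskian q ψ χ (2 * k) = boundaryForm (rescaledPair q k ψ) (rescaledPair q k χ) := by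
  have hpow : (q : ℂ) ^ (-(2 * k)) = (-q : ℂ) ^ (-k) * (-q : ℂ) ^ (-k) := by
    rw [← mul_zpow, neg_mul_neg, ← mul_neg, zpow_mul, zpow_ofNat, sq]
  simp only [wronskian, boundaryForm_apply, rescaledPair_apply, map_mul, map_zpow₀, map_neg,
    Complex.conj_ofReal, hpow]
  ring

theorem exists_tendsto_rescaledPair (hq₀ : 0 < q) (hq₁ : q < 1) {ψ : ℤ → ℂ} {C : ℝ}
    (hψ : ∀ n, ‖jacobi q ψ n‖ ≤ C) : ∃ x, Tendsto (rescaledPair q · ψ) atTop (𝓝 x) := by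
  refine exists_tendsto_atTop_of_norm_sub_le_geometric (C := C) hq₁ fun k => ?_
  have hpow : q ^ (2 * k + 2) ≤ q ^ (2 * k + 1) :=
    zpow_le_zpow_right_of_le_one₀ hq₀ hq₁.le (by lia)
  rw [rescaledPair_succ_sub hq₀.ne', norm_smul, Prod.norm_mk]
  simp only [norm_mul, norm_zpow, norm_neg, Complex.norm_real, Real.norm_of_nonneg hq₀.le]
  calc q ^ (-(k + 1)) * max (q ^ (2 * k + 1) * ‖jacobi q ψ (2 * k + 1)‖)
        (q ^ (2 * k + 2) * ‖jacobi q ψ (2 * k + 2)‖)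
      ≤ q ^ (-(k + 1)) * (q ^ (2 * k + 1) * C) := by
        gcongr
        exact max_le (by gcongr; exact hψ _) (by gcongr; exact hψ _)
    _ = C * q ^ k := by
        rw [← mul_assoc, ← zpow_add₀ hq₀.ne', mul_comm]
        ring_nf

theorem tendsto_limUnder_rescaledPair (hq₀ : 0 < q) (hq₁ : q < 1) (ψ : (Amax q).domain) :
    Tendsto (rescaledPair q · (ψ : ellTwo)) atTop
      (𝓝 (limUnder atTop (rescaledPair q · (ψ : ellTwo)))) :=
  tendsto_nhds_limUnder <| exists_tendsto_rescaledPair hq₀ hq₁ (ψ := (ψ : ellTwo)) fun n =>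
    lp.norm_apply_le_norm two_ne_zero (Amax q ψ) n

/-- The boundary values at `+∞` of a vector in the domain of the maximal operator: the limit of its
rescaled pairs. -/
def boundaryMap (hq₀ : 0 < q) (hq₁ : q < 1) : (Amax q).domain →ₗ[ℂ] ℂ × ℂ where
  toFun ψ := limUnder atTop (rescaledPair q · (ψ : ellTwo))
  map_add' ψ χ := by
    refine Tendsto.limUnder_eq (((tendsto_limUnder_rescaledPair hq₀ hq₁ ψ).add
      (tendsto_limUnder_rescaledPair hq₀ hq₁ χ)).congr fun k => ?_)
    exact (map_add (rescaledPair q k) ((ψ : ellTwo) : ℤ → ℂ) (χ : ellTwo)).symm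
  map_smul' c ψ := by
    refine Tendsto.limUnder_eq
      (((tendsto_limUnder_rescaledPair hq₀ hq₁ ψ).const_smul c).congr fun k => ?_)
    exact (map_smul (rescaledPair q k) c ((ψ : ellTwo) : ℤ → ℂ)).symm

theorem tendsto_rescaledPair (hq₀ : 0 < q) (hq₁ : q < 1) (ψ : (Amax q).domain) :
    Tendsto (rescaledPair q · (ψ : ellTwo)) atTop (𝓝 (boundaryMap hq₀ hq₁ ψ)) :=
  tendsto_limUnder_rescaledPair hq₀ hq₁ ψ

end BoundaryMap

section GreenIdentity

open scoped InnerProductSpace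

variable {q : ℝ}

theorem tendsto_wronskian_atBot (hq₀ : 0 < q) (hq₁ : q < 1) {ψ χ : ℤ → ℂ} {C D : ℝ}
    (hψ : ∀ n, ‖ψ n‖ ≤ C) (hχ : ∀ n, ‖χ n‖ ≤ D) :
    Tendsto (wronskian q ψ χ) atBot (𝓝 0) := by
  have hpow : Tendsto (fun n : ℤ => q ^ (-n)) atBot (𝓝 0) := by
    refine Tendsto.comp (g := fun n : ℤ => q ^ n) ?_ tendsto_neg_atBot_atTop
    rw [← Nat.map_cast_int_atTop, tendsto_map'_iff]
    simpa [Function.comp_def] using tendsto_pow_atTop_nhds_zero_of_lt_one hq₀.le hq₁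
  have hbound : Tendsto (fun n : ℤ => q ^ (-n) * (C * D + C * D)) atBot (𝓝 0) :=
    zero_mul (C * D + C * D) ▸ hpow.mul_const (C * D + C * D)
  have hmul (m l : ℤ) : ‖conj (ψ m) * χ l‖ ≤ C * D := by
    rw [norm_mul, RCLike.norm_conj]
    exact mul_le_mul (hψ m) (hχ l) (norm_nonneg _) ((norm_nonneg _).trans (hψ m))
  refine squeeze_zero_norm (fun n => ?_) hbound
  rw [wronskian, norm_mul, norm_zpow, Complex.norm_real, Real.norm_of_nonneg hq₀.le]
  gcongr
  exact norm_sub_le_of_le (hmul _ _) (hmul _ _)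

theorem hasSum_wronskian_sub (ψ χ : (Amax q).domain) :
    HasSum (fun n => wronskian q (ψ : ellTwo) (χ : ellTwo) n -
        wronskian q (ψ : ellTwo) (χ : ellTwo) (n - 1))
      (⟪Amax q ψ, (χ : ellTwo)⟫_ℂ - ⟪(ψ : ellTwo), Amax q χ⟫_ℂ) := by
  refine ((lp.hasSum_inner (𝕜 := ℂ) (Amax q ψ) (χ : ellTwo)).sub
    (lp.hasSum_inner (𝕜 := ℂ) (ψ : ellTwo) (Amax q χ))).congr_fun fun n => ?_
  simp only [RCLike.inner_apply, Amax_apply, wronskian, map_add, map_mul, map_zpow₀,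
    Complex.conj_ofReal, sub_add_cancel, neg_sub', sub_neg_eq_add]
  ring

theorem inner_Amax_sub_inner (hq₀ : 0 < q) (hq₁ : q < 1) (ψ χ : (Amax q).domain) :
    ⟪Amax q ψ, (χ : ellTwo)⟫_ℂ - ⟪(ψ : ellTwo), Amax q χ⟫_ℂ =
      boundaryForm (boundaryMap hq₀ hq₁ ψ) (boundaryMap hq₀ hq₁ χ) := by
  have hbounded (φ : ellTwo) (n : ℤ) : ‖φ n‖ ≤ ‖φ‖ := lp.norm_apply_le_norm two_ne_zero φ n
  have hinner : Tendsto (wronskian q (ψ : ellTwo) (χ : ellTwo)) atTop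
      (𝓝 (⟪Amax q ψ, (χ : ellTwo)⟫_ℂ - ⟪(ψ : ellTwo), Amax q χ⟫_ℂ)) := by
    simpa only [add_zero] using tendsto_atTop_of_hasSum_sub (hasSum_wronskian_sub ψ χ)
      (tendsto_wronskian_atBot hq₀ hq₁ (hbounded ψ) (hbounded χ))
  refine tendsto_nhds_unique (hinner.comp (tendsto_id.const_mul_atTop' two_pos)) ?_
  refine (tendsto_boundaryForm (tendsto_rescaledPair hq₀ hq₁ ψ)
    (tendsto_rescaledPair hq₀ hq₁ χ)).congr fun k => ?_
  exact (wronskian_two_mul (ψ : ellTwo) (χ : ellTwo) k).symm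

end GreenIdentity

noncomputable section BoundarySequence

variable {q : ℝ}

/-- The sequence with boundary values `v` and `u` that vanishes at the negative integers and is
annihilated by the Jacobi matrix away from the origin. -/
def boundarySeq (q : ℝ) (v u : ℂ) (n : ℤ) : ℂ :=
  if 0 ≤ n then (-q : ℂ) ^ (n / 2) * (if Even n then v else u) else 0

theorem boundarySeq_two_mul (q : ℝ) (v u : ℂ) {k : ℤ} (hk : 0 ≤ k) :
    boundarySeq q v u (2 * k) = (-q : ℂ) ^ k * v := by
  rw [boundarySeq, if_pos (by lia), if_pos (even_two_mul k),
    Int.mul_ediv_cancel_left k two_ne_zero]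

theorem boundarySeq_two_mul_add_one (q : ℝ) (v u : ℂ) {k : ℤ} (hk : 0 ≤ k) :
    boundarySeq q v u (2 * k + 1) = (-q : ℂ) ^ k * u := by
  rw [boundarySeq, if_pos (by lia), if_neg (Int.not_even_two_mul_add_one k),
    show (2 * k + 1) / 2 = k by lia]

theorem boundarySeq_of_neg (q : ℝ) (v u : ℂ) {n : ℤ} (hn : n < 0) : boundarySeq q v u n = 0 :=
  if_neg hn.not_ge

theorem memℓp_boundarySeq (hq₀ : 0 < q) (hq₁ : q < 1) (v u : ℂ) :
    Memℓp (boundarySeq q v u) 2 := by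
  have hsum (c : ℂ) : Summable fun k : ℕ => ‖(-q : ℂ) ^ (k : ℤ) * c‖ ^ 2 := by
    refine ((summable_geometric_of_lt_one (sq_nonneg q)
      (pow_lt_one₀ hq₀.le hq₁ two_ne_zero)).mul_right (‖c‖ ^ 2)).congr fun k => ?_
    rw [norm_mul, norm_zpow, norm_neg, Complex.norm_real, Real.norm_of_nonneg hq₀.le,
      zpow_natCast, mul_pow, pow_right_comm]
  refine memℓp_gen ?_
  simp only [ENNReal.toReal_ofNat, Real.rpow_ofNat]
  refine Summable.of_nat_of_neg_add_one ?_ ?_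
  · refine (HasSum.even_add_odd ((hsum v).congr fun k => ?_).hasSum
      ((hsum u).congr fun k => ?_).hasSum).summable
    · rw [← boundarySeq_two_mul q v u (Int.natCast_nonneg k)]
      push_cast
      rfl
    · rw [← boundarySeq_two_mul_add_one q v u (Int.natCast_nonneg k)]
      push_cast
      rfl
  · refine summable_zero.congr fun n => ?_
    rw [boundarySeq_of_neg q v u (by lia), norm_zero, zero_pow two_ne_zero]

theorem rescaledPair_boundarySeq (hq : q ≠ 0) (v u : ℂ) {k : ℤ} (hk : 0 ≤ k) :
    rescaledPair q k (boundarySeq q v u) = (v, u) := by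
  have hpow : (-q : ℂ) ^ k ≠ 0 := zpow_ne_zero k (neg_ne_zero.2 (by exact_mod_cast hq))
  rw [rescaledPair_apply, boundarySeq_two_mul q v u hk, boundarySeq_two_mul_add_one q v u hk,
    zpow_neg, inv_mul_cancel_left₀ hpow, inv_mul_cancel_left₀ hpow]

theorem jacobi_boundarySeq_of_lt_neg_one (q : ℝ) (v u : ℂ) {n : ℤ} (hn : n < -1) :
    jacobi q (boundarySeq q v u) n = 0 := by
  simp only [jacobi, LinearMap.coe_mk, AddHom.coe_mk]
  rw [boundarySeq_of_neg q v u (by lia), boundarySeq_of_neg q v u (by lia), mul_zero, mul_zero,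
    add_zero]

theorem jacobi_boundarySeq_of_pos (hq : q ≠ 0) (v u : ℂ) {n : ℤ} (hn : 0 < n) :
    jacobi q (boundarySeq q v u) n = 0 := by
  have hqC : (q : ℂ) ≠ 0 := by exact_mod_cast hq
  have hpair (k : ℤ) (hk : 0 ≤ k) : jacobi q (boundarySeq q v u) (2 * k + 1) = 0 ∧
      jacobi q (boundarySeq q v u) (2 * k + 2) = 0 := by
    have h := rescaledPair_succ_sub hq (boundarySeq q v u) k
    rw [rescaledPair_boundarySeq hq v u hk, rescaledPair_boundarySeq hq v u (by lia), sub_self,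
      eq_comm, smul_eq_zero_iff_right (zpow_ne_zero _ (neg_ne_zero.2 hqC)), Prod.mk_eq_zero,
      mul_eq_zero_iff_left (zpow_ne_zero _ hqC), mul_eq_zero_iff_left (zpow_ne_zero _ hqC)] at h
    exact h
  obtain ⟨k, rfl | rfl⟩ : ∃ k, n = 2 * k + 1 ∨ n = 2 * k + 2 := ⟨(n - 1) / 2, by lia⟩
  · exact (hpair k (by lia)).1
  · exact (hpair k (by lia)).2

theorem memℓp_jacobi_boundarySeq (hq : q ≠ 0) (v u : ℂ) :
    Memℓp (jacobi q (boundarySeq q v u)) 2 := by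
  have hzero : Memℓp (jacobi q (boundarySeq q v u)) 0 := by
    refine memℓp_zero ((Set.finite_Icc (-1) 0).subset fun n hn => ⟨?_, ?_⟩) <;>
      by_contra! h <;> refine hn ?_
    · exact jacobi_boundarySeq_of_lt_neg_one q v u h
    · exact jacobi_boundarySeq_of_pos hq v u h
  exact hzero.of_exponent_ge zero_le

theorem boundaryMap_surjective (hq₀ : 0 < q) (hq₁ : q < 1) :
    Function.Surjective (boundaryMap hq₀ hq₁) := by
  rintro ⟨v, u⟩
  refine ⟨⟨⟨boundarySeq q v u, memℓp_boundarySeq hq₀ hq₁ v u⟩,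
    memℓp_jacobi_boundarySeq hq₀.ne' v u⟩, ?_⟩
  refine tendsto_nhds_unique (tendsto_rescaledPair hq₀ hq₁ _) (tendsto_const_nhds.congr' ?_)
  filter_upwards [eventually_ge_atTop 0] with k hk
  exact (rescaledPair_boundarySeq hq₀.ne' v u hk).symm

end BoundarySequence

section Extensions

variable {q : ℝ}

theorem isBoundaryMap (hq₀ : 0 < q) (hq₁ : q < 1) :
    IsBoundaryMap (A q) (Amax q) boundaryForm (boundaryMap hq₀ hq₁) where
  dense_domain := dense_A_domain q
  le := A_le_Amax q
  adjoint_eq := adjoint_A q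
  surjective := boundaryMap_surjective hq₀ hq₁
  green := inner_Amax_sub_inner hq₀ hq₁

theorem boundaryCondition_iff_mem_boundaryLine (hq : q ≠ 0) {ψ : ℤ → ℂ} {x : ℂ × ℂ}
    (hx : Tendsto (rescaledPair q · ψ) atTop (𝓝 x)) (t : OnePoint ℝ) :
    BoundaryCondition q t ψ ↔ x ∈ boundaryLine t := by
  have hiff {f : ℤ → ℂ} {a : ℂ} (h : Tendsto (fun k => (-q : ℂ) ^ (-k) * f k) atTop (𝓝 a)) :
      Tendsto (fun k => (q : ℂ) ^ (-k) * f k) atTop (𝓝 0) ↔ a = 0 :=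
    (tendsto_neg_zpow_mul_zero_iff Neg.neg f).symm.trans ⟨tendsto_nhds_unique h, fun ha => ha ▸ h⟩
  have heven : Tendsto (fun k => (-q : ℂ) ^ (-k) * ψ (2 * k)) atTop (𝓝 x.1) := hx.fst_nhds
  have hodd : Tendsto (fun k => (-q : ℂ) ^ (-k) * ψ (2 * k + 1)) atTop (𝓝 x.2) := hx.snd_nhds
  induction t using OnePoint.rec with
  | infty => exact hiff heven
  | coe t =>
    have hright : Tendsto (fun k => (-q : ℂ) ^ (-k) * (ψ (2 * k + 1) + t * ψ (2 * k))) atTop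
        (𝓝 (x.2 + t * x.1)) :=
      (hodd.add (heven.const_mul (t : ℂ))).congr fun k => by ring
    have hleft : Tendsto (fun k => (-q : ℂ) ^ (-k) * (q * ψ (2 * k - 1) - t * ψ (2 * k))) atTop
        (𝓝 (-(x.2 + t * x.1))) := by
      have hpred := hodd.comp (tendsto_atTop_add_const_right atTop (-1 : ℤ) tendsto_id)
      refine (hpred.add (heven.const_mul (t : ℂ))).neg.congr fun k => ?_
      have hpow : (-q : ℂ) ^ (-(k + -1)) = (-q : ℂ) ^ (-k) * -q := by
        rw [← zpow_add_one₀ (neg_ne_zero.2 (by exact_mod_cast hq)), neg_add, neg_neg]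
      simp only [Function.comp_apply, id, hpow, show 2 * (k + -1) + 1 = 2 * k - 1 by ring]
      ring
    rw [mem_boundaryLine_coe]
    exact (and_congr (hiff hright) ((hiff hleft).trans neg_eq_zero)).trans (and_self_iff)

theorem At_eq_boundaryRestriction (hq₀ : 0 < q) (hq₁ : q < 1) (t : OnePoint ℝ) :
    At q t = boundaryRestriction (Amax q) (boundaryMap hq₀ hq₁) (boundaryLine t) :=
  eq_boundaryRestriction (At_le_Amax q t) fun ψ => (and_iff_right ψ.2).trans <|
    boundaryCondition_iff_mem_boundaryLine hq₀.ne' (tendsto_rescaledPair hq₀ hq₁ ψ) t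

end Extensions

end QJacobi

theorem mainTheorem7 (q : ℝ) (hq₀ : 0 < q) (hq₁ : q < 1) :
    {T : QJacobi.ellTwo →ₗ.[ℂ] QJacobi.ellTwo | QJacobi.A q ≤ T ∧ IsSelfAdjoint T}
      = Set.range (QJacobi.At q) := by
  calc {T | QJacobi.A q ≤ T ∧ IsSelfAdjoint T}
    _ = boundaryRestriction (QJacobi.Amax q) (QJacobi.boundaryMap hq₀ hq₁) ''
          {L | L.orthogonalBilin QJacobi.boundaryForm = L} :=
        (QJacobi.isBoundaryMap hq₀ hq₁).setOf_isSelfAdjoint_eq_image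
    _ = boundaryRestriction (QJacobi.Amax q) (QJacobi.boundaryMap hq₀ hq₁) ''
          Set.range QJacobi.boundaryLine := by
        rw [QJacobi.setOf_orthogonalBilin_boundaryForm_eq_self]
    _ = Set.range (QJacobi.At q) := by
        rw [← Set.range_comp]
        exact congrArg Set.range
          (funext fun t => (QJacobi.At_eq_boundaryRestriction hq₀ hq₁ t).symm)
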